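/- Let $D=d_1d_2$, where $D$, $d_1$ and $d_2$ are discriminants of quadratic number fields, and suppose that the Kronecker symbol $\left(\frac{d_2}{p}\right)$ equals $1$ for every prime $p\mid d_1$ and that $\left(\frac{d_1}{p}\right)$ equals $1$ for every prime $p\mid d_2$. Let $x,y,z$ be integers with $\gcd(x,y,z)=1$ and $x^2-d_1y^2-d_2z^2=0$. Then there exists $t\in\{\pm1,\pm2\}$ such that the field $$F_t=\mathbf{Q}\left(\sqrt{d_1},\sqrt{d_2},\sqrt{tx+ty\sqrt{d_1}}\right)$$ is a cyclic extension of $\mathbf{Q}(\sqrt D)$ of degree $4$ that is unramified at all finite primes. -/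

import Mathlib

/-- `D` is a quadratic discriminant: the discriminant of the quadratic field `ℚ(√d)` for a
squarefree integer `d ≠ 1`, that is, `d` if `d ≡ 1 mod 4` and `4d` otherwise. -/
def IsQuadraticDiscriminant (D : ℤ) : Prop :=
  ∃ d : ℤ, Squarefree d ∧ d ≠ 1 ∧ D = if d % 4 = 1 then d else 4 * d

/-- A discriminantal decomposition: a quadratic discriminant `D` written as the product of two
quadratic discriminants. -/
structure IsDiscriminantalDecomposition (D d₁ d₂ : ℤ) : Prop where
  isDiscr : IsQuadraticDiscriminant D
  isDiscr₁ : IsQuadraticDiscriminant d₁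
  isDiscr₂ : IsQuadraticDiscriminant d₂
  eq_mul : D = d₁ * d₂

/-- The Kronecker symbol `(a / p)` for a prime `p`: the Legendre symbol for odd `p`; for `p = 2` it
is `0` if `a` is even, `1` if `a ≡ ±1 mod 8` and `-1` if `a ≡ ±3 mod 8`. -/
def kroneckerAtPrime (a : ℤ) (p : ℕ) [Fact p.Prime] : ℤ :=
  if p = 2 then ZMod.χ₈ (a : ZMod 8) else legendreSym p a

/-- A discriminantal decomposition `D = d₁d₂` such that, for every prime `p` dividing one of the
two factors, the Kronecker symbol of the other factor at `p` equals `1`. -/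
structure SatisfiesRedeiConditions (D d₁ d₂ : ℤ) : Prop
    extends IsDiscriminantalDecomposition D d₁ d₂ where
  symbol₁ : ∀ (p : ℕ) [Fact p.Prime], (p : ℤ) ∣ d₁ → kroneckerAtPrime d₂ p = 1
  symbol₂ : ∀ (p : ℕ) [Fact p.Prime], (p : ℤ) ∣ d₂ → kroneckerAtPrime d₁ p = 1

/-- The extension `L / K` is unramified at all finite primes: `𝓞 L` is unramified over `𝓞 K` at
every nonzero prime ideal of `𝓞 L`. No condition is imposed at the infinite primes. -/
def IsFinitelyUnramified (K L : Type*) [Field K] [Field L] [Algebra K L] : Prop :=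
  ∀ (P : Ideal (NumberField.RingOfIntegers L)) [P.IsPrime], P ≠ ⊥ →
    Algebra.IsUnramifiedAt (NumberField.RingOfIntegers K) P

/-- `L / K` is a Galois extension of degree `4` with cyclic Galois group. -/
structure IsCyclicQuartic (K L : Type*) [Field K] [Field L] [Algebra K L] : Prop where
  isGalois : IsGalois K L
  isCyclic : IsCyclic (L ≃ₐ[K] L)
  finrank_eq : Module.finrank K L = 4

/-!
Put `K = ℚ(√D)` and `β = t (x + y√d₁)`. The norm `t²(x² - d₁y²) = t²d₂z²` of `β` is `d₁` times a
square of `K`, because `d₁d₂ = D` is one; by the classical criterion `K(√d₁, √β) / K` is then cyclic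
of degree `4`. Its Galois group has a unique element `g` of order `2`, which fixes `√d₁` and sends
`√β` to `-√β`, so a prime `P` ramifies only if `g` lies in the inertia group of `P`. If `P ∤ 2`,
this puts `β` and its conjugate into `P`, although `x` and `d₁y²` have no odd common prime factor.
If `P ∣ 2`, it is impossible as soon as `β` or its conjugate is, locally at `P`, a square modulo `4`
times an even power of `2`: after dividing out the power of `2`, half of the sum of `√β` and a local
square root is an integer which `g` moves by a unit.

A twist `t` with this property exists for `(d₁, y)` or for `(d₂, z)`, and
`(x + y√d₁ + z√d₂)² = 2 (x + y√d₁) (x + z√d₂)` shows that the field attached to `(d₁, y)` with twist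
`t` is the field attached to `(d₂, z)` with twist `2 / t`.
-/

theorem dvd_of_sq_dvd_mul_sq {M : Type*} [CommMonoidWithZero M] [IsCancelMulZero M] {p a n : M}
    (hp : Prime p) (ha : ¬ p ^ 2 ∣ a) (h : p ^ 2 ∣ a * n ^ 2) : p ∣ n := by
  by_contra hn
  exact ha (hp.pow_dvd_of_dvd_mul_right 2 (fun h ↦ hn (hp.dvd_of_dvd_pow h)) h)

theorem eq_zero_of_sq_eq_mul_sq {a m n : ℤ} (ha : ¬ IsSquare a) (h : m ^ 2 = a * n ^ 2) :
    n = 0 := by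
  by_contra hn
  obtain ⟨k, rfl⟩ : n ∣ m := (Int.pow_dvd_pow_iff two_ne_zero).mp (h ▸ dvd_mul_left _ _)
  exact ha ⟨k, mul_right_cancel₀ (pow_ne_zero 2 hn) (by linear_combination -h)⟩

namespace IsQuadraticDiscriminant

variable {D : ℤ}

theorem not_isSquare (hD : IsQuadraticDiscriminant D) : ¬ IsSquare D := by
  obtain ⟨d, hsf, hne, rfl⟩ := hD
  have hd : ¬ IsSquare d := by
    rintro ⟨n, rfl⟩
    exact hne (Int.isUnit_mul_self (hsf n dvd_rfl))
  split_ifs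
  · exact hd
  · rintro ⟨n, hn⟩
    obtain ⟨k, rfl⟩ : (2 : ℤ) ∣ n := Int.prime_two.dvd_of_dvd_pow (n := 2) ⟨2 * d, by linarith⟩
    exact hd ⟨k, by linarith⟩

theorem ne_zero (hD : IsQuadraticDiscriminant D) : D ≠ 0 := by
  rintro rfl
  exact hD.not_isSquare IsSquare.zero

theorem emod_four_eq_one_or_four_dvd (hD : IsQuadraticDiscriminant D) : D % 4 = 1 ∨ 4 ∣ D := by
  obtain ⟨d, -, -, rfl⟩ := hD
  split_ifs with hd
  · exact Or.inl hd
  · exact Or.inr (dvd_mul_right _ _)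

theorem modEq_one_of_not_two_dvd (hD : IsQuadraticDiscriminant D) (h2 : ¬ 2 ∣ D) :
    D ≡ 1 [ZMOD 4] :=
  hD.emod_four_eq_one_or_four_dvd.resolve_right fun h4 ↦ h2 (dvd_trans ⟨2, rfl⟩ h4)

theorem not_sq_dvd (hD : IsQuadraticDiscriminant D) {p : ℕ} (hp : p.Prime) (hodd : Odd p) :
    ¬ (p : ℤ) ^ 2 ∣ D := by
  have hpi : Prime (p : ℤ) := Nat.prime_iff_prime_int.mp hp
  have hp4 : ¬ (p : ℤ) ∣ 4 := fun h ↦ by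
    have hp2 : p ∣ 2 := hp.dvd_of_dvd_pow (n := 2) (Int.natCast_dvd_natCast.mp h)
    exact hodd.ne_two_of_dvd_nat dvd_rfl ((Nat.prime_dvd_prime_iff_eq hp Nat.prime_two).mp hp2)
  obtain ⟨d, hsf, -, rfl⟩ := hD
  have hd : ¬ (p : ℤ) ^ 2 ∣ d := fun h ↦ hpi.not_isUnit (hsf _ (sq (p : ℤ) ▸ h))
  split_ifs
  · exact hd
  · exact fun h ↦ hd (hpi.pow_dvd_of_dvd_mul_left 2 hp4 h)

end IsQuadraticDiscriminant

theorem kroneckerAtPrime_eq_zero_of_dvd {a : ℤ} {p : ℕ} [Fact p.Prime] (h : (p : ℤ) ∣ a) :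
    kroneckerAtPrime a p = 0 := by
  unfold kroneckerAtPrime
  split_ifs with hp
  · subst hp
    rw [ZMod.χ₈_int_eq_if_mod_eight, if_pos (Int.emod_eq_zero_of_dvd (by exact_mod_cast h))]
  · exact (legendreSym.eq_zero_iff p a).mpr ((ZMod.intCast_zmod_eq_zero_iff_dvd a p).mpr h)

theorem emod_eight_eq_one_or_seven_of_kroneckerAtPrime_two {a : ℤ}
    (h : kroneckerAtPrime a 2 = 1) : a % 8 = 1 ∨ a % 8 = 7 := by
  rw [kroneckerAtPrime, if_pos rfl, ZMod.χ₈_int_eq_if_mod_eight] at h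
  split_ifs at h with heven hmod
  · exact absurd h zero_ne_one
  · exact hmod

/-- A primitive integral solution `(x, y, z)` of the conic `x² - d₁y² - d₂z² = 0` attached to
`(d₁, d₂)`. -/
structure IsPrimitiveSolution (d₁ d₂ x y z : ℤ) : Prop where
  gcd_eq_one : Int.gcd (Int.gcd x y) z = 1
  eq_zero : x ^ 2 - d₁ * y ^ 2 - d₂ * z ^ 2 = 0

namespace IsPrimitiveSolution

variable {d₁ d₂ x y z : ℤ}

theorem symm (h : IsPrimitiveSolution d₁ d₂ x y z) : IsPrimitiveSolution d₂ d₁ x z y where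
  gcd_eq_one := by rw [Int.gcd_assoc, Int.gcd_comm z y, ← Int.gcd_assoc, h.gcd_eq_one]
  eq_zero := by linarith [h.eq_zero]

theorem isUnit_of_dvd (h : IsPrimitiveSolution d₁ d₂ x y z) {p : ℤ} (hx : p ∣ x) (hy : p ∣ y)
    (hz : p ∣ z) : IsUnit p :=
  isUnit_of_dvd_one (by simpa [h.gcd_eq_one] using Int.dvd_coe_gcd (Int.dvd_coe_gcd hx hy) hz)

theorem ne_zero (h : IsPrimitiveSolution d₁ d₂ x y z) (hd₁ : ¬ IsSquare d₁) : z ≠ 0 := by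
  rintro rfl
  have hy : y = 0 := eq_zero_of_sq_eq_mul_sq hd₁ (m := x) (by linarith [h.eq_zero])
  subst hy
  have hx : x = 0 := pow_eq_zero_iff two_ne_zero |>.mp (by linarith [h.eq_zero])
  simpa [hx] using h.gcd_eq_one

theorem odd_and_even_or_even (h : IsPrimitiveSolution d₁ d₂ x y z) (hd₁ : d₁ ≡ 1 [ZMOD 4])
    (hd₂ : d₂ ≡ 1 [ZMOD 4]) : Odd x ∧ (Even y ∨ Even z) := by
  have hmod : x ^ 2 % 4 = (y ^ 2 + z ^ 2) % 4 := by
    refine Int.ModEq.eq (?_ : x ^ 2 ≡ _ [ZMOD 4])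
    calc x ^ 2 = d₁ * y ^ 2 + d₂ * z ^ 2 := by linarith [h.eq_zero]
      _ ≡ 1 * y ^ 2 + 1 * z ^ 2 [ZMOD 4] := (hd₁.mul_right _).add (hd₂.mul_right _)
      _ = y ^ 2 + z ^ 2 := by ring
  have hnot : ¬ (Even x ∧ Even y ∧ Even z) := fun ⟨hx, hy, hz⟩ ↦
    Int.prime_two.not_isUnit (h.isUnit_of_dvd hx.two_dvd hy.two_dvd hz.two_dvd)
  have sq_mod_four (n : ℤ) : Even n ∧ n ^ 2 % 4 = 0 ∨ Odd n ∧ n ^ 2 % 4 = 1 :=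
    n.even_or_odd.imp
      (fun hn ↦ ⟨hn, Int.emod_eq_zero_of_dvd (pow_dvd_pow_of_dvd hn.two_dvd 2)⟩)
      (fun hn ↦ ⟨hn, Int.sq_mod_four_eq_one_of_odd hn⟩)
  rcases sq_mod_four x with ⟨hx, hx4⟩ | ⟨hx, hx4⟩ <;>
    rcases sq_mod_four y with ⟨hy, hy4⟩ | ⟨hy, hy4⟩ <;>
    rcases sq_mod_four z with ⟨hz, hz4⟩ | ⟨hz, hz4⟩ <;> first | omega | tauto

end IsPrimitiveSolution

namespace SatisfiesRedeiConditions

variable {D d₁ d₂ x y z : ℤ}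

theorem symm (h : SatisfiesRedeiConditions D d₁ d₂) : SatisfiesRedeiConditions D d₂ d₁ where
  isDiscr := h.isDiscr
  isDiscr₁ := h.isDiscr₂
  isDiscr₂ := h.isDiscr₁
  eq_mul := h.eq_mul.trans (mul_comm _ _)
  symbol₁ := h.symbol₂
  symbol₂ := h.symbol₁

theorem not_dvd (h : SatisfiesRedeiConditions D d₁ d₂) {p : ℕ} (hp : p.Prime)
    (h₁ : (p : ℤ) ∣ d₁) : ¬ (p : ℤ) ∣ d₂ := fun h₂ ↦ by
  have : Fact p.Prime := ⟨hp⟩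
  exact zero_ne_one ((kroneckerAtPrime_eq_zero_of_dvd h₂).symm.trans (h.symbol₁ p h₁))

theorem emod_eight_eq_one (h : SatisfiesRedeiConditions D d₁ d₂) (h₂ : 2 ∣ d₂) :
    d₁ % 8 = 1 := by
  have h8 := emod_eight_eq_one_or_seven_of_kroneckerAtPrime_two (h.symbol₂ 2 h₂)
  have h4 := h.isDiscr₁.emod_four_eq_one_or_four_dvd
  omega

theorem not_dvd_of_dvd (h : SatisfiesRedeiConditions D d₁ d₂)
    (hxyz : IsPrimitiveSolution d₁ d₂ x y z) {p : ℕ} (hp : p.Prime) (hodd : Odd p)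
    (hx : (p : ℤ) ∣ x) : ¬ (p : ℤ) ∣ d₁ * y ^ 2 := fun hdy ↦ by
  have hpi : Prime (p : ℤ) := Nat.prime_iff_prime_int.mp hp
  have hx2 : (p : ℤ) ^ 2 ∣ x ^ 2 := pow_dvd_pow_of_dvd hx 2
  have hy : (p : ℤ) ∣ y := by
    refine (hpi.dvd_or_dvd hdy).elim (fun hd₁ ↦ ?_) hpi.dvd_of_dvd_pow
    have hdz : (p : ℤ) ∣ d₂ * z ^ 2 := by
      rw [show d₂ * z ^ 2 = x ^ 2 - d₁ * y ^ 2 by linarith [hxyz.eq_zero]]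
      exact dvd_sub (dvd_pow hx two_ne_zero) hdy
    have hz : (p : ℤ) ∣ z :=
      hpi.dvd_of_dvd_pow ((hpi.dvd_or_dvd hdz).resolve_left (h.not_dvd hp hd₁))
    refine dvd_of_sq_dvd_mul_sq hpi (h.isDiscr₁.not_sq_dvd hp hodd) ?_
    rw [show d₁ * y ^ 2 = x ^ 2 - d₂ * z ^ 2 by linarith [hxyz.eq_zero]]
    exact dvd_sub hx2 ((pow_dvd_pow_of_dvd hz 2).mul_left _)
  have hz : (p : ℤ) ∣ z := by
    refine dvd_of_sq_dvd_mul_sq hpi (h.isDiscr₂.not_sq_dvd hp hodd) ?_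
    rw [show d₂ * z ^ 2 = x ^ 2 - d₁ * y ^ 2 by linarith [hxyz.eq_zero]]
    exact dvd_sub hx2 ((pow_dvd_pow_of_dvd hy 2).mul_left _)
  exact hpi.not_isUnit (hxyz.isUnit_of_dvd hx hy hz)

theorem exists_gcd_eq_two_pow (h : SatisfiesRedeiConditions D d₁ d₂)
    (hxyz : IsPrimitiveSolution d₁ d₂ x y z) : ∃ n : ℕ, Int.gcd x (d₁ * y ^ 2) = 2 ^ n := by
  refine (Nat.eq_two_pow_or_exists_odd_prime_and_dvd _).resolve_right ?_
  rintro ⟨p, hp, hdvd, hodd⟩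
  have hdvd' : (p : ℤ) ∣ Int.gcd x (d₁ * y ^ 2) := Int.natCast_dvd_natCast.mpr hdvd
  exact h.not_dvd_of_dvd hxyz hp hodd (hdvd'.trans (Int.gcd_dvd_left ..))
    (hdvd'.trans (Int.gcd_dvd_right ..))

end SatisfiesRedeiConditions

/-- The condition on a twist `t` under which `√(t(x + y√d))` generates an extension of
`ℚ(√d, √(x² - dy²))` that is unramified at the primes above `2`. Either `t(x + y√d) ≡ 1` modulo
`4ℤ[(1 + √d)/2]`, or `2` splits in `ℚ(√d)` and `t(x + y√d)` is a unit `≡ 1` modulo `4` times a power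
of `4` at one of the two places above `2`; there `√d` is approximated by the odd integer `r`. -/
inductive IsTwoAdicTwist (d x y t : ℤ) : Prop
  | of_even (hd : d ≡ 1 [ZMOD 4]) (hy : Even y) (ht : t * (x - y) ≡ 1 [ZMOD 4])
  | of_split (r : ℤ) (j : ℕ) (hr : Odd r) (hd : d ≡ r ^ 2 [ZMOD 2 * 4 ^ (j + 1)])
      (ht : t * (x + y * r) ≡ 4 ^ j [ZMOD 4 ^ (j + 1)])

theorem exists_odd_sq_modEq {d : ℤ} (hd : d % 8 = 1) (n : ℕ) :
    ∃ r : ℤ, Odd r ∧ 2 ^ (n + 3) ∣ d - r ^ 2 := by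
  induction n with
  | zero => exact ⟨1, odd_one, by norm_num; omega⟩
  | succ n ih =>
    obtain ⟨r, hr, k, hk⟩ := ih
    rcases Int.even_or_odd' k with ⟨l, rfl | rfl⟩
    · exact ⟨r, hr, l, by rw [hk]; ring⟩
    · obtain ⟨q, rfl⟩ := hr
      exact ⟨2 * q + 1 + 2 ^ (n + 2), ⟨q + 2 ^ (n + 1), by ring⟩, l - q - 2 ^ n,
        by linear_combination hk⟩

theorem exists_isUnit_mul_modEq_one {n : ℤ} (hn : Odd n) :
    ∃ e : ℤ, (e = 1 ∨ e = -1) ∧ e * n ≡ 1 [ZMOD 4] := by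
  have h2 : n % 2 = 1 := Int.odd_iff.mp hn
  rcases (by omega : n % 4 = 1 ∨ n % 4 = 3) with h | h
  · exact ⟨1, Or.inl rfl, by rw [one_mul]; exact h⟩
  · exact ⟨-1, Or.inr rfl, by unfold Int.ModEq; omega⟩

theorem exists_mul_modEq_four_pow {b : ℤ} (hb : b ≠ 0) :
    ∃ t ∈ ({1, -1, 2, -2} : Set ℤ), ∃ j : ℕ, t * b ≡ 4 ^ j [ZMOD 4 ^ (j + 1)] := by
  have hfin : FiniteMultiplicity (2 : ℤ) b := Int.finiteMultiplicity_iff.mpr ⟨by norm_num, hb⟩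
  obtain ⟨n, hbn, hn⟩ := hfin.exists_eq_pow_mul_and_not_dvd
  obtain ⟨e, he, hen⟩ := exists_isUnit_mul_modEq_one (Int.not_even_iff_odd.mp fun h ↦ hn h.two_dvd)
  have four_pow_mul (j : ℕ) : 4 ^ j * (e * n) ≡ 4 ^ j [ZMOD 4 ^ (j + 1)] := by
    simpa only [mul_one, ← pow_succ] using hen.mul_left' (c := 4 ^ j)
  rcases Nat.even_or_odd' (multiplicity 2 b) with ⟨j, hj | hj⟩
  · refine ⟨e, by rcases he with rfl | rfl <;> simp, j, ?_⟩
    convert four_pow_mul j using 1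
    rw [hbn, hj, pow_mul]
    ring
  · refine ⟨2 * e, by rcases he with rfl | rfl <;> simp, j + 1, ?_⟩
    convert four_pow_mul (j + 1) using 1
    rw [hbn, hj, pow_succ, pow_mul]
    ring

theorem exists_mem_mul_eq_two {t : ℤ} (ht : t ∈ ({1, -1, 2, -2} : Set ℤ)) :
    ∃ e ∈ ({1, -1, 2, -2} : Set ℤ), t * e = 2 := by
  rcases ht with rfl | rfl | rfl | rfl
  exacts [⟨2, by simp⟩, ⟨-2, by simp⟩, ⟨1, by simp⟩, ⟨-1, by simp⟩]

theorem dvd_two_of_mem {t : ℤ} (ht : t ∈ ({1, -1, 2, -2} : Set ℤ)) : t ∣ 2 :=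
  let ⟨e, _, he⟩ := exists_mem_mul_eq_two ht
  Dvd.intro e he

theorem exists_isTwoAdicTwist_of_emod_eight {d x y : ℤ} (hd : d % 8 = 1)
    (hne : x ^ 2 - d * y ^ 2 ≠ 0) :
    ∃ t ∈ ({1, -1, 2, -2} : Set ℤ), IsTwoAdicTwist d x y t := by
  have hfin : FiniteMultiplicity 2 (x ^ 2 - d * y ^ 2) :=
    Int.finiteMultiplicity_iff.mpr ⟨by norm_num, hne⟩
  obtain ⟨n, hn⟩ : ∃ n : ℕ, ¬ 2 ^ n ∣ x ^ 2 - d * y ^ 2 := hfin.elim fun n hn ↦ ⟨n + 1, hn⟩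
  -- As `2 ^ n ∤ x + y r` below bounds `j`, this precision of `r` suffices for every possible `j`.
  obtain ⟨r, hr, hdr⟩ := exists_odd_sq_modEq hd (n + 1)
  have hb : ¬ (2 : ℤ) ^ n ∣ x + y * r := fun hdvd ↦ hn <| by
    rw [show x ^ 2 - d * y ^ 2 = (x + y * r) * (x - y * r) - y ^ 2 * (d - r ^ 2) by ring]
    exact dvd_sub (hdvd.mul_right _) (((pow_dvd_pow 2 (by omega)).trans hdr).mul_left _)
  obtain ⟨t, ht, j, hj⟩ := exists_mul_modEq_four_pow (b := x + y * r)
    fun h ↦ hb (h ▸ dvd_zero _)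
  have h2j : (2 : ℤ) ^ (2 * j) ∣ 2 * (x + y * r) := by
    rw [pow_mul]
    have h4 := (hj.of_dvd (pow_dvd_pow 4 j.le_succ)).dvd_iff.mpr dvd_rfl
    exact h4.trans (mul_dvd_mul_right (dvd_two_of_mem ht) _)
  have hjn : 2 * j ≤ n + 1 := by
    by_contra! hlt
    refine hb ((mul_dvd_mul_iff_left two_ne_zero).mp ?_)
    exact (pow_succ' (2 : ℤ) n ▸ pow_dvd_pow 2 (by omega : n + 1 ≤ 2 * j)).trans h2j
  refine ⟨t, ht, .of_split r j hr (Int.modEq_iff_dvd.mpr ?_).symm hj⟩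
  rw [show (2 : ℤ) * 4 ^ (j + 1) = 2 ^ (2 * j + 3) by rw [pow_succ, pow_add, pow_mul]; ring]
  exact (pow_dvd_pow 2 (by omega)).trans hdr

theorem exists_isTwoAdicTwist_of_even {d x y : ℤ} (hd : d ≡ 1 [ZMOD 4]) (hx : Odd x)
    (hy : Even y) : ∃ t ∈ ({1, -1, 2, -2} : Set ℤ), IsTwoAdicTwist d x y t := by
  obtain ⟨t, ht, hmod⟩ := exists_isUnit_mul_modEq_one (hx.sub_even hy)
  exact ⟨t, by rcases ht with rfl | rfl <;> simp, .of_even hd hy hmod⟩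

theorem SatisfiesRedeiConditions.exists_isTwoAdicTwist_of_two_dvd {D d₁ d₂ x y z : ℤ}
    (h : SatisfiesRedeiConditions D d₁ d₂) (hxyz : IsPrimitiveSolution d₁ d₂ x y z)
    (h₂ : 2 ∣ d₂) : ∃ t ∈ ({1, -1, 2, -2} : Set ℤ), IsTwoAdicTwist d₁ x y t := by
  refine exists_isTwoAdicTwist_of_emod_eight (h.emod_eight_eq_one h₂) ?_
  rw [sub_eq_zero.mp hxyz.eq_zero]
  exact mul_ne_zero h.isDiscr₂.ne_zero (pow_ne_zero 2 (hxyz.ne_zero h.isDiscr₁.not_isSquare))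

theorem SatisfiesRedeiConditions.exists_isTwoAdicTwist {D d₁ d₂ x y z : ℤ}
    (h : SatisfiesRedeiConditions D d₁ d₂) (hxyz : IsPrimitiveSolution d₁ d₂ x y z) :
    ∃ t ∈ ({1, -1, 2, -2} : Set ℤ), IsTwoAdicTwist d₁ x y t ∨ IsTwoAdicTwist d₂ x z t := by
  by_cases h₂ : 2 ∣ d₂
  · exact (h.exists_isTwoAdicTwist_of_two_dvd hxyz h₂).imp fun _ ↦ .imp_right .inl
  by_cases h₁ : 2 ∣ d₁
  · exact (h.symm.exists_isTwoAdicTwist_of_two_dvd hxyz.symm h₁).imp fun _ ↦ .imp_right .inr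
  have hd₁ := h.isDiscr₁.modEq_one_of_not_two_dvd h₁
  have hd₂ := h.isDiscr₂.modEq_one_of_not_two_dvd h₂
  obtain ⟨hx, hy | hz⟩ := hxyz.odd_and_even_or_even hd₁ hd₂
  · exact (exists_isTwoAdicTwist_of_even hd₁ hx hy).imp fun _ ↦ .imp_right .inl
  · exact (exists_isTwoAdicTwist_of_even hd₂ hx hz).imp fun _ ↦ .imp_right .inr

theorem two_dvd_add_of_sq_eq {R : Type*} [CommRing R] [IsDomain R] [IsIntegrallyClosed R]
    [NeZero (2 : R)] {u w e : R} (h : w ^ 2 = u ^ 2 + 4 * e) : 2 ∣ u + w := by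
  let f := algebraMap R (FractionRing R)
  have hf : Function.Injective f := IsFractionRing.injective R (FractionRing R)
  have h2 : (2 : FractionRing R) ≠ 0 := by
    simpa only [map_ofNat] using (map_ne_zero_iff f hf).mpr (two_ne_zero (α := R))
  have hint : IsIntegral R ((f u + f w) / 2) := by
    refine ⟨Polynomial.X ^ 2 - Polynomial.C u * Polynomial.X - Polynomial.C e, by monicity!, ?_⟩
    have hfw : f w ^ 2 = f u ^ 2 + 4 * f e := by
      simpa only [map_pow, map_add, map_mul, map_ofNat] using congrArg f h
    change Polynomial.eval₂ f _ _ = 0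
    simp only [Polynomial.eval₂_sub, Polynomial.eval₂_mul, Polynomial.eval₂_pow,
      Polynomial.eval₂_X, Polynomial.eval₂_C]
    field_simp
    linear_combination hfw
  obtain ⟨a, ha⟩ := IsIntegrallyClosed.isIntegral_iff.mp hint
  refine ⟨a, hf ?_⟩
  rw [map_mul, map_ofNat, map_add, (ha : f a = _), mul_div_cancel₀ _ h2]

section Inertia

variable {R G : Type*} [CommRing R] [Group G] [MulSemiringAction G R] {P : Ideal R} {g : G}

theorem smul_intCast_eq (g : G) (n : ℤ) : g • (n : R) = n :=
  map_intCast (MulSemiringAction.toRingHom G R g) n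

theorem smul_eq_of_two_mul_eq [IsDomain R] [NeZero (2 : R)] {a b c : R} (h : 2 * a = b)
    (h' : g • b = 2 * c) : g • a = c := by
  rw [← h, two_mul, smul_add, ← two_mul] at h'
  exact mul_left_cancel₀ two_ne_zero h'

theorem notMem_inertia_of_sq_eq [IsDomain R] [IsIntegrallyClosed R] [NeZero (2 : R)] [P.IsPrime]
    (h2 : 2 ∈ P) {m w e : R} (hw : w ^ 2 = m ^ 2 + 4 * e) (hm : m ∉ P) (hgm : g • m = m)
    (hgw : g • w = -w) : g ∉ P.inertia G := fun hg ↦ by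
  obtain ⟨v, hv⟩ := two_dvd_add_of_sq_eq hw
  have hgv : g • v = v - w :=
    smul_eq_of_two_mul_eq hv.symm (by rw [smul_add, hgm, hgw]; linear_combination hv)
  have hwP : -(g • v - v) ∈ P := neg_mem (hg v)
  rw [hgv, sub_sub_cancel_left, neg_neg] at hwP
  refine hm (Ideal.IsPrime.mem_of_pow_mem ‹_› 2 ?_)
  rw [show m ^ 2 = w * w - 2 * (2 * e) by linear_combination -hw]
  exact sub_mem (P.mul_mem_left _ hwP) (P.mul_mem_right _ h2)

theorem notMem_inertia_of_sq_eq_four_pow_mul [IsDomain R] [IsIntegrallyClosed R] [NeZero (2 : R)]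
    [P.IsPrime] (h2 : 2 ∈ P) {m w e : R} {j : ℕ} (hw : w ^ 2 = 4 ^ j * (m ^ 2 + 4 * e))
    (hm : m ∉ P) (hgm : g • m = m) (hgw : g • w = -w) : g ∉ P.inertia G := by
  have h4 : (4 : R) ^ j = (2 ^ j) ^ 2 := by rw [← pow_mul', pow_mul]; norm_num
  have h2j : (2 : R) ^ j ≠ 0 := pow_ne_zero j two_ne_zero
  rw [h4] at hw
  obtain ⟨v, rfl⟩ := (IsIntegrallyClosed.pow_dvd_pow_iff two_ne_zero).mp (Dvd.intro _ hw.symm)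
  have hg2 : g • (2 ^ j : R) = 2 ^ j := by exact_mod_cast smul_intCast_eq (R := R) g (2 ^ j)
  rw [smul_mul', hg2, ← mul_neg] at hgw
  exact notMem_inertia_of_sq_eq h2 (mul_left_cancel₀ (pow_ne_zero 2 h2j) (by rw [← mul_pow, hw]))
    hm hgm (mul_left_cancel₀ h2j hgw)

theorem notMem_inertia_of_half_notMem [IsDomain R] [IsIntegrallyClosed R] [NeZero (2 : R)]
    [P.IsPrime] (h2 : 2 ∈ P) {a b r q h m σ s : R} {j : ℕ}
    (hσ : σ ^ 2 = r ^ 2 + 2 * 4 ^ (j + 1) * h) (hs : s ^ 2 = a + b * σ)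
    (hab : a + b * r = 4 ^ j * (1 + 4 * q)) (hm : 2 * m = r + σ)
    (hmP : m ∉ P) (hgm : g • m = m) (hgs : g • s = -s) : g ∉ P.inertia G := by
  -- `σ - r` alone need not be divisible by `4 ^ (j + 1)`: multiplying `s` by `m` makes it so, and
  -- replacing `σ` by `r` in `(m s)²` then changes it only by a multiple of `4 ^ (j + 1)`.
  have hmσ : m * (σ - r) = 4 ^ (j + 1) * h :=
    mul_left_cancel₀ (two_ne_zero (α := R)) (by linear_combination hσ + (σ - r) * hm)
  have hsq : (m * s) ^ 2 = 4 ^ j * (m ^ 2 + 4 * (q * m ^ 2 + b * h * m)) := by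
    rw [mul_pow, hs]
    linear_combination m ^ 2 * hab + b * m * hmσ
  exact notMem_inertia_of_sq_eq_four_pow_mul h2 hsq hmP hgm (by rw [smul_mul', hgm, hgs, mul_neg])

theorem notMem_inertia_of_sq_eq_add_four_pow [IsDomain R] [IsIntegrallyClosed R] [NeZero (2 : R)]
    [P.IsPrime] (h2 : 2 ∈ P) {a b r q h σ s s' : R} {j : ℕ}
    (hσ : σ ^ 2 = r ^ 2 + 2 * 4 ^ (j + 1) * h) (hs : s ^ 2 = a + b * σ) (hs' : s' ^ 2 = a - b * σ)
    (hab : a + b * r = 4 ^ j * (1 + 4 * q)) (hr : r ∉ P) (hgr : g • r = r) (hgσ : g • σ = σ)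
    (hgs : g • s = -s) (hgs' : g • s' = -s') : g ∉ P.inertia G := by
  -- The integers `(r + σ) / 2` and `(r - σ) / 2` have sum `r ∉ P`, so one of them is not in `P`.
  obtain ⟨m, hm⟩ := two_dvd_add_of_sq_eq (u := r) (w := σ) (e := 2 * 4 ^ j * h)
    (by linear_combination hσ)
  have hgm : g • m = m := smul_eq_of_two_mul_eq hm.symm (by rw [smul_add, hgr, hgσ, hm])
  by_cases hmP : m ∈ P
  · have hrm : r - m ∉ P := fun h ↦ hr (by simpa only [sub_add_cancel] using add_mem h hmP)
    exact notMem_inertia_of_half_notMem h2 (σ := -σ) (by rw [neg_sq, hσ]) (by rw [hs']; ring) hab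
      (by linear_combination hm) hrm (by rw [smul_sub, hgr, hgm]) hgs'
  · exact notMem_inertia_of_half_notMem h2 hσ hs hab hm.symm hmP hgm hgs

theorem mem_of_mem_inertia_of_smul_eq_neg [P.IsPrime] (h2 : 2 ∉ P) (hg : g ∈ P.inertia G) {a : R}
    (ha : g • a = -a) : a ∈ P := by
  refine (Ideal.IsPrime.mem_or_mem ‹_› (?_ : 2 * a ∈ P)).resolve_left h2
  have hsub : -(g • a - a) ∈ P := neg_mem (hg a)
  rwa [ha, show -(-a - a) = 2 * a by ring] at hsub

theorem notMem_inertia_of_two_notMem [P.IsPrime] (h2 : 2 ∉ P) {a b s s' : R}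
    (hs : s ^ 2 = a + b) (hs' : s' ^ 2 = a - b) (hab : a ∈ P → b ∉ P) (hgs : g • s = -s)
    (hgs' : g • s' = -s') : g ∉ P.inertia G := fun hg ↦ by
  have hadd : a + b ∈ P :=
    hs ▸ P.pow_mem_of_mem (mem_of_mem_inertia_of_smul_eq_neg h2 hg hgs) 2 two_pos
  have hsub : a - b ∈ P :=
    hs' ▸ P.pow_mem_of_mem (mem_of_mem_inertia_of_smul_eq_neg h2 hg hgs') 2 two_pos
  have ha : a ∈ P := by
    refine (Ideal.IsPrime.mem_or_mem ‹_› (?_ : 2 * a ∈ P)).resolve_left h2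
    rw [show 2 * a = a + b + (a - b) by ring]
    exact add_mem hadd hsub
  exact hab ha ((P.add_mem_iff_right ha).mp hadd)

theorem two_mem_of_intCast_mem [P.IsPrime] {a b : ℤ} {n : ℕ} (hgcd : Int.gcd a b = 2 ^ n)
    (ha : (a : R) ∈ P) (hb : (b : R) ∈ P) : 2 ∈ P := by
  refine Ideal.IsPrime.mem_of_pow_mem ‹_› n ?_
  have hbezout : (2 : R) ^ n = a * Int.gcdA a b + b * Int.gcdB a b := by
    exact_mod_cast congrArg (Int.cast (R := R)) (hgcd ▸ Int.gcd_eq_gcd_ab a b)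
  rw [hbezout]
  exact add_mem (P.mul_mem_right _ ha) (P.mul_mem_right _ hb)

theorem exists_intCast_eq_add_mul {a b n : ℤ} (h : a ≡ b [ZMOD n]) :
    ∃ q : R, (a : R) = b + n * q := by
  obtain ⟨q, hq⟩ := h.symm.dvd
  exact ⟨q, by rw [← sub_eq_iff_eq_add']; exact_mod_cast congrArg (Int.cast (R := R)) hq⟩

theorem intCast_notMem_of_odd [P.IsPrime] (h2 : 2 ∈ P) {r : ℤ} (hr : Odd r) : (r : R) ∉ P := by
  obtain ⟨k, rfl⟩ := hr
  intro h
  push_cast at h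
  exact Ideal.one_notMem P ((P.add_mem_iff_right (P.mul_mem_right _ h2)).mp h)

theorem IsTwoAdicTwist.notMem_inertia_of_two_mem [IsDomain R] [IsIntegrallyClosed R]
    [NeZero (2 : R)] [P.IsPrime] {d x y t : ℤ} (htwist : IsTwoAdicTwist d x y t) (h2 : 2 ∈ P)
    {σ s s' : R} (hσ : σ ^ 2 = d) (hs : s ^ 2 = t * x + t * y * σ)
    (hs' : s' ^ 2 = t * x - t * y * σ) (hgσ : g • σ = σ) (hgs : g • s = -s)
    (hgs' : g • s' = -s') : g ∉ P.inertia G := by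
  rcases htwist with ⟨hd, ⟨k, rfl⟩, ht⟩ | ⟨r, j, hr, hd, ht⟩
  · obtain ⟨f, hf⟩ := exists_intCast_eq_add_mul (R := R) hd
    obtain ⟨q, hq⟩ := exists_intCast_eq_add_mul (R := R) ht
    push_cast at hf hq hs
    obtain ⟨ω, hω⟩ : 2 ∣ 1 + σ := two_dvd_add_of_sq_eq (e := f) (by rw [hσ, hf, one_pow])
    exact notMem_inertia_of_sq_eq h2 (m := 1) (e := q + t * k * ω)
      (by linear_combination hs + hq + 2 * t * k * hω) (Ideal.one_notMem P) (smul_one g) hgs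
  · obtain ⟨f, hf⟩ := exists_intCast_eq_add_mul (R := R) hd
    obtain ⟨q, hq⟩ := exists_intCast_eq_add_mul (R := R) ht
    push_cast at hf hq
    exact notMem_inertia_of_sq_eq_add_four_pow h2 (q := q) (hσ.trans hf) hs hs'
      (by linear_combination hq) (intCast_notMem_of_odd h2 hr) (smul_intCast_eq g r) hgσ hgs hgs'

theorem IsTwoAdicTwist.notMem_inertia [IsDomain R] [IsIntegrallyClosed R] [NeZero (2 : R)]
    [P.IsPrime] {d x y t : ℤ} (htwist : IsTwoAdicTwist d x y t) (ht : t ∣ 2) {n : ℕ}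
    (hgcd : Int.gcd x (d * y ^ 2) = 2 ^ n) {σ s s' : R} (hσ : σ ^ 2 = d)
    (hs : s ^ 2 = t * x + t * y * σ) (hs' : s' ^ 2 = t * x - t * y * σ) (hgσ : g • σ = σ)
    (hgs : g • s = -s) (hgs' : g • s' = -s') : g ∉ P.inertia G := by
  by_cases h2 : 2 ∈ P
  · exact htwist.notMem_inertia_of_two_mem h2 hσ hs hs' hgσ hgs hgs'
  have htP : (t : R) ∉ P := fun htP ↦ h2 <| by
    simpa only [map_ofNat] using Ideal.mem_of_dvd P (map_dvd (Int.castRingHom R) ht) htP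
  refine notMem_inertia_of_two_notMem h2 hs hs' (fun hx hy ↦ h2 ?_) hgs hgs'
  rw [mul_assoc] at hy
  have hxP : (x : R) ∈ P := (Ideal.IsPrime.mem_or_mem ‹_› hx).resolve_left htP
  have hyP : y * σ ∈ P := (Ideal.IsPrime.mem_or_mem ‹_› hy).resolve_left htP
  refine two_mem_of_intCast_mem hgcd hxP ?_
  push_cast
  rw [← hσ, ← mul_pow, mul_comm]
  exact P.pow_mem_of_mem hyP 2 two_pos

end Inertia

theorem splits_X_sq_sub_C_sq {F : Type*} [Field F] (r : F) :
    (Polynomial.X ^ 2 - Polynomial.C (r ^ 2)).Splits := by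
  rw [Polynomial.C_pow, sq_sub_sq]
  exact (Polynomial.Splits.X_add_C r).mul (Polynomial.Splits.X_sub_C r)

/-- `L = K(σ, s)` with `σ² = d`, `σ ∉ K` and `s² = a + bσ`, where `a² - db² = dk²` with `k ≠ 0`.
This is the classical criterion for the square root of an element of the quadratic extension
`K(√d)` to generate a cyclic quartic extension of `K`: its norm is `d` times a square. -/
structure IsQuarticGenerator {K L : Type*} [Field K] [Field L] [Algebra K L] (d a b k : K)
    (σ s : L) : Prop where
  sq₁ : σ ^ 2 = algebraMap K L d
  sq : s ^ 2 = algebraMap K L a + algebraMap K L b * σ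
  norm_eq : a ^ 2 - d * b ^ 2 = d * k ^ 2
  ne_zero : k ≠ 0
  notMem : σ ∉ Set.range (algebraMap K L)
  adjoin_eq_top : IntermediateField.adjoin K {σ, s} = ⊤

namespace IsQuarticGenerator

variable {K L : Type*} [Field K] [Field L] [Algebra K L] {d a b k : K} {σ s : L}

theorem gen₁_ne_zero (H : IsQuarticGenerator d a b k σ s) : σ ≠ 0 :=
  fun h ↦ H.notMem ⟨0, by rw [h, map_zero]⟩

theorem sq_mul_sub (H : IsQuarticGenerator d a b k σ s) :
    s ^ 2 * (algebraMap K L a - algebraMap K L b * σ) = (algebraMap K L k * σ) ^ 2 := by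
  have hnorm := congrArg (algebraMap K L) H.norm_eq
  simp only [map_sub, map_mul, map_pow] at hnorm
  rw [H.sq, mul_pow, H.sq₁]
  linear_combination hnorm - algebraMap K L b ^ 2 * H.sq₁

theorem gen_ne_zero (H : IsQuarticGenerator d a b k σ s) : s ≠ 0 := by
  rintro rfl
  have hkσ := H.sq_mul_sub
  rw [zero_pow two_ne_zero, zero_mul, eq_comm, sq_eq_zero_iff, mul_eq_zero, map_eq_zero] at hkσ
  exact hkσ.elim H.ne_zero H.gen₁_ne_zero

theorem conj_sq (H : IsQuarticGenerator d a b k σ s) :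
    (algebraMap K L k * σ / s) ^ 2 = algebraMap K L a - algebraMap K L b * σ := by
  rw [div_pow, ← H.sq_mul_sub, mul_div_cancel_left₀ _ (pow_ne_zero 2 H.gen_ne_zero)]

theorem exists_isSplittingField (H : IsQuarticGenerator d a b k σ s) :
    ∃ p : Polynomial K, Polynomial.IsSplittingField K L p := by
  let p : Polynomial K := (Polynomial.X ^ 2 - Polynomial.C d) *
    ((Polynomial.X ^ 2 - Polynomial.C a) ^ 2 - Polynomial.C (d * b ^ 2))
  set s' := algebraMap K L k * σ / s
  have hmap : p.map (algebraMap K L) = (Polynomial.X ^ 2 - Polynomial.C (σ ^ 2)) *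
      ((Polynomial.X ^ 2 - Polynomial.C (s ^ 2)) * (Polynomial.X ^ 2 - Polynomial.C (s' ^ 2))) := by
    have hσ := congrArg Polynomial.C H.sq₁
    rw [Polynomial.C_pow] at hσ
    simp only [p, H.sq₁, H.sq, s', H.conj_sq, Polynomial.map_mul, Polynomial.map_sub,
      Polynomial.map_pow, Polynomial.map_X, Polynomial.map_C, Polynomial.C_add, Polynomial.C_sub,
      map_mul, map_pow]
    linear_combination (Polynomial.X ^ 2 - Polynomial.C (algebraMap K L d)) *
      Polynomial.C (algebraMap K L b) ^ 2 * hσ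
  have hne : p.map (algebraMap K L) ≠ 0 := by
    rw [hmap]
    exact mul_ne_zero (Polynomial.X_pow_sub_C_ne_zero two_pos _)
      (mul_ne_zero (Polynomial.X_pow_sub_C_ne_zero two_pos _)
        (Polynomial.X_pow_sub_C_ne_zero two_pos _))
  refine ⟨p, isSplittingField_iff_intermediateField.mpr ⟨?_, top_le_iff.mp ?_⟩⟩
  · rw [hmap]
    exact (splits_X_sq_sub_C_sq σ).mul ((splits_X_sq_sub_C_sq s).mul (splits_X_sq_sub_C_sq s'))
  · rw [← H.adjoin_eq_top]
    refine IntermediateField.adjoin.mono K _ _ ?_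
    rintro c hc
    rw [Polynomial.mem_rootSet', Polynomial.aeval_def, ← Polynomial.eval_map, hmap]
    rw [hmap] at hne
    refine ⟨hne, ?_⟩
    rcases hc with rfl | rfl <;> simp

theorem finiteDimensional (H : IsQuarticGenerator d a b k σ s) : FiniteDimensional K L := by
  obtain ⟨p, hp⟩ := H.exists_isSplittingField
  exact Polynomial.IsSplittingField.finiteDimensional L p

theorem isGalois [CharZero K] (H : IsQuarticGenerator d a b k σ s) : IsGalois K L := by
  obtain ⟨p, hp⟩ := H.exists_isSplittingField
  have := H.finiteDimensional
  have := Normal.of_isSplittingField (F := K) (E := L) p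
  constructor

theorem apply_gen₁ (H : IsQuarticGenerator d a b k σ s) (g : L ≃ₐ[K] L) : g σ = σ ∨ g σ = -σ :=
  sq_eq_sq_iff_eq_or_eq_neg.mp (by rw [← map_pow, H.sq₁, g.commutes])

theorem apply_gen (H : IsQuarticGenerator d a b k σ s) {g : L ≃ₐ[K] L} (hg : g σ = σ) :
    g s = s ∨ g s = -s :=
  sq_eq_sq_iff_eq_or_eq_neg.mp <| by
    rw [← map_pow, H.sq, map_add, map_mul, hg, g.commutes, g.commutes]

theorem algEquiv_ext (H : IsQuarticGenerator d a b k σ s) {g h : L ≃ₐ[K] L} (h₁ : g σ = h σ)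
    (h₂ : g s = h s) : g = h := by
  ext c
  have hc : c ∈ IntermediateField.adjoin K {σ, s} := H.adjoin_eq_top ▸ IntermediateField.mem_top
  induction hc using IntermediateField.adjoin_induction with
  | mem c hc => rcases hc with rfl | rfl <;> assumption
  | algebraMap r => rw [g.commutes, h.commutes]
  | add c e _ _ hc he => rw [map_add, map_add, hc, he]
  | inv c _ hc => rw [map_inv₀, map_inv₀, hc]
  | mul c e _ _ hc he => rw [map_mul, map_mul, hc, he]

theorem apply_apply_gen (H : IsQuarticGenerator d a b k σ s) {g : L ≃ₐ[K] L} (hg : g σ = -σ) :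
    g (g s) = -s := by
  have hgs : g s ^ 2 = (algebraMap K L k * σ / s) ^ 2 := by
    rw [H.conj_sq, ← map_pow, H.sq, map_add, map_mul, hg, g.commutes, g.commutes, mul_neg,
      sub_eq_add_neg]
  have happly : g (algebraMap K L k * σ / s) = -(algebraMap K L k * σ) / g s := by
    rw [map_div₀, map_mul, g.commutes, hg, mul_neg]
  have hkσ : algebraMap K L k * σ ≠ 0 :=
    mul_ne_zero ((map_ne_zero _).mpr H.ne_zero) H.gen₁_ne_zero
  rcases sq_eq_sq_iff_eq_or_eq_neg.mp hgs with h | h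
  · nth_rewrite 1 [h]
    rw [happly, h, neg_div, div_div_cancel₀ hkσ]
  · nth_rewrite 1 [h]
    rw [map_neg, happly, h, neg_div_neg_eq, div_div_cancel₀ hkσ]

theorem sq_apply_gen₁ (H : IsQuarticGenerator d a b k σ s) (τ : L ≃ₐ[K] L) :
    (τ ^ 2) σ = σ := by
  rw [pow_two, AlgEquiv.mul_apply]
  rcases H.apply_gen₁ τ with h | h
  · rw [h, h]
  · rw [h, map_neg, h, neg_neg]

theorem sq_apply_gen (H : IsQuarticGenerator d a b k σ s) {τ : L ≃ₐ[K] L} (hτ : τ σ = -σ) :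
    (τ ^ 2) s = -s :=
  H.apply_apply_gen hτ

theorem apply_of_orderOf_eq_two [CharZero L] (H : IsQuarticGenerator d a b k σ s)
    {g : L ≃ₐ[K] L} (hg : orderOf g = 2) : g σ = σ ∧ g s = -s := by
  obtain ⟨hgg, hne⟩ := orderOf_eq_prime_iff.mp hg
  have hσ : g σ = σ := (H.apply_gen₁ g).resolve_right fun hσ ↦ H.gen_ne_zero <| self_eq_neg.mp <|
    calc s = (g ^ 2) s := by rw [hgg, AlgEquiv.one_apply]
      _ = -s := by rw [pow_two, AlgEquiv.mul_apply, H.apply_apply_gen hσ]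
  exact ⟨hσ, (H.apply_gen hσ).resolve_left fun hs ↦ hne (H.algEquiv_ext hσ hs)⟩

theorem orderOf_eq_four [CharZero L] (H : IsQuarticGenerator d a b k σ s) {τ : L ≃ₐ[K] L}
    (hτ : τ σ = -σ) : orderOf τ = 4 := by
  refine orderOf_eq_prime_pow (p := 2) (n := 1) (fun h ↦ H.gen_ne_zero ?_) ?_
  · rw [← self_eq_neg, ← H.sq_apply_gen hτ, ← pow_one 2, h, AlgEquiv.one_apply]
  · rw [pow_succ, pow_one, pow_mul, pow_two (τ ^ 2)]
    refine H.algEquiv_ext ?_ ?_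
    · simp only [AlgEquiv.mul_apply, AlgEquiv.one_apply, H.sq_apply_gen₁]
    · simp only [AlgEquiv.mul_apply, AlgEquiv.one_apply, H.sq_apply_gen hτ, map_neg, neg_neg]

theorem mem_zpowers (H : IsQuarticGenerator d a b k σ s) {τ : L ≃ₐ[K] L} (hτ : τ σ = -σ)
    (g : L ≃ₐ[K] L) : g ∈ Subgroup.zpowers τ := by
  have mem_of_fixes (g : L ≃ₐ[K] L) (hg : g σ = σ) : g ∈ Subgroup.zpowers τ := by
    rcases H.apply_gen hg with hs | hs
    · rw [H.algEquiv_ext (h := 1) hg hs]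
      exact one_mem _
    · rw [H.algEquiv_ext (h := τ ^ 2) (hg.trans (H.sq_apply_gen₁ τ).symm)
        (hs.trans (H.sq_apply_gen hτ).symm)]
      exact Subgroup.npow_mem_zpowers τ 2
  rcases H.apply_gen₁ g with hg | hg
  · exact mem_of_fixes g hg
  · refine (Subgroup.mul_mem_cancel_right _ (Subgroup.mem_zpowers τ)).mp (mem_of_fixes (g * τ) ?_)
    rw [AlgEquiv.mul_apply, hτ, map_neg, hg, neg_neg]

theorem isCyclicQuartic [CharZero K] (H : IsQuarticGenerator d a b k σ s) :
    IsCyclicQuartic K L := by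
  have := H.finiteDimensional
  have := H.isGalois
  have := charZero_of_injective_algebraMap (algebraMap K L).injective
  obtain ⟨τ, hτ⟩ : ∃ τ : L ≃ₐ[K] L, τ σ ≠ σ := by
    by_contra! hfixed
    exact H.notMem ((IsGalois.mem_range_algebraMap_iff_fixed σ).mpr hfixed)
  replace hτ := (H.apply_gen₁ τ).resolve_left hτ
  exact
    { isGalois := H.isGalois
      isCyclic := ⟨τ, H.mem_zpowers hτ⟩
      finrank_eq := by
        rw [← IsGalois.card_aut_eq_finrank,
          ← orderOf_eq_card_of_forall_mem_zpowers (H.mem_zpowers hτ), H.orderOf_eq_four hτ] }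

end IsQuarticGenerator

section Unramified

open NumberField

variable {K L : Type*} [Field K] [Field L] [NumberField K] [NumberField L] [Algebra K L]

theorem isFinitelyUnramified_of_inertia_eq_bot [IsGalois K L]
    (h : ∀ P : Ideal (𝓞 L), P.IsPrime → P ≠ ⊥ → P.inertia (L ≃ₐ[K] L) = ⊥) :
    IsFinitelyUnramified K L := by
  intro P hPprime hP
  have hp : P.under (𝓞 K) ≠ ⊥ := mt Ideal.eq_bot_of_comap_eq_bot hP
  have : (P.under (𝓞 K)).IsMaximal := Ideal.IsPrime.isMaximal inferInstance hp
  have : Finite (𝓞 K ⧸ P.under (𝓞 K)) := Ideal.finiteQuotientOfFreeOfNeBot _ hp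
  have : Finite (P.under (𝓞 K)).ResidueField :=
    Finite.of_surjective _ (Ideal.bijective_algebraMap_quotient_residueField _).surjective
  have hcard := Ideal.card_inertia_eq_ramificationIdxIn (G := L ≃ₐ[K] L) (P.under (𝓞 K)) P
  rw [Ideal.ramificationIdxIn_eq_ramificationIdx _ P (L ≃ₐ[K] L), h P hPprime hP,
    Subgroup.card_bot] at hcard
  exact Ideal.ramificationIdx_eq_one_iff.mp hcard.symm

theorem isFinitelyUnramified_of_isPGroup [IsGalois K L] {p : ℕ} [Fact p.Prime]
    (hp : IsPGroup p (L ≃ₐ[K] L))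
    (h : ∀ P : Ideal (𝓞 L), P.IsPrime → P ≠ ⊥ → ∀ g : L ≃ₐ[K] L, orderOf g = p →
      g ∉ P.inertia (L ≃ₐ[K] L)) :
    IsFinitelyUnramified K L := by
  refine isFinitelyUnramified_of_inertia_eq_bot fun P hPprime hP ↦ ?_
  by_contra hI
  have hnontrivial : Nontrivial (P.inertia (L ≃ₐ[K] L)) := (Subgroup.nontrivial_iff_ne_bot _).mpr hI
  obtain ⟨n, hn, hcard⟩ := (hp.to_subgroup _).nontrivial_iff_card.mp hnontrivial
  obtain ⟨g, hg⟩ := exists_prime_orderOf_dvd_card' p (hcard ▸ dvd_pow_self p hn.ne')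
  exact h P hPprime hP g (by rwa [Subgroup.orderOf_coe]) g.2

theorem exists_ringOfIntegers_coe_eq_of_sq_eq {F : Type*} [Field F] {a : F}
    {b : 𝓞 F} (h : a ^ 2 = algebraMap _ F b) :
    ∃ c, algebraMap (𝓞 F) F c = a :=
  ⟨⟨a, .of_pow two_pos (h ▸ NumberField.RingOfIntegers.isIntegral_coe b)⟩, rfl⟩

theorem IsQuarticGenerator.isFinitelyUnramified {d x y t : ℤ} {k : K} {σ s : L}
    (H : IsQuarticGenerator (d : K) (t * x) (t * y) k σ s) (htwist : IsTwoAdicTwist d x y t)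
    (ht : t ∣ 2) {n : ℕ} (hgcd : Int.gcd x (d * y ^ 2) = 2 ^ n) : IsFinitelyUnramified K L := by
  have := H.isGalois
  have hcard : Nat.card (L ≃ₐ[K] L) = 2 ^ 2 :=
    (IsGalois.card_aut_eq_finrank K L).trans H.isCyclicQuartic.finrank_eq
  refine isFinitelyUnramified_of_isPGroup (IsPGroup.of_card hcard) fun P _ _ g hg ↦ ?_
  obtain ⟨hgσ, hgs⟩ := H.apply_of_orderOf_eq_two hg
  obtain ⟨s', hs'⟩ : ∃ s', algebraMap K L k * σ / s = s' := ⟨_, rfl⟩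
  have hgs' : g s' = -s' := by rw [← hs', map_div₀, map_mul, g.commutes, hgσ, hgs, div_neg]
  have hσ_sq := H.sq₁
  have hs_sq := H.sq
  have hs'_sq := H.conj_sq
  rw [hs'] at hs'_sq
  clear hs' H
  simp only [map_mul, map_intCast] at hσ_sq hs_sq hs'_sq
  obtain ⟨σ, rfl⟩ := exists_ringOfIntegers_coe_eq_of_sq_eq (b := (d : 𝓞 L)) (by simpa using hσ_sq)
  obtain ⟨s, rfl⟩ := exists_ringOfIntegers_coe_eq_of_sq_eq (b := (t * x + t * y * σ : 𝓞 L))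
    (by simpa using hs_sq)
  obtain ⟨s', rfl⟩ := exists_ringOfIntegers_coe_eq_of_sq_eq (b := (t * x - t * y * σ : 𝓞 L))
    (by simpa using hs'_sq)
  exact htwist.notMem_inertia ht hgcd (σ := σ) (s := s) (s' := s')
    (RingOfIntegers.ext (by simpa using hσ_sq)) (RingOfIntegers.ext (by simpa using hs_sq))
    (RingOfIntegers.ext (by simpa using hs'_sq)) (RingOfIntegers.ext hgσ)
    (RingOfIntegers.ext hgs) (RingOfIntegers.ext hgs')

end Unramified

section Adjoin

open IntermediateField

variable {F E : Type*} [Field F] [Field E] [Algebra F E]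

theorem adjoin_insert_of_mem {S : Set E} {u : E} (hu : u ∈ adjoin F S) :
    adjoin F (insert u S) = adjoin F S := by
  rw [← adjoin_insert_adjoin, Set.insert_eq_of_mem hu, adjoin_self]

theorem adjoin_insert_div {S : Set E} {w : E} (hw : w ∈ adjoin F S) (hw₀ : w ≠ 0) (u : E) :
    adjoin F (insert (w / u) S) = adjoin F (insert u S) := by
  have mem_insert (v : E) : w / v ∈ adjoin F (insert v S) :=
    div_mem (adjoin.mono F _ _ (Set.subset_insert v S) hw)
      (subset_adjoin F _ (Set.mem_insert v S))
  have hu : u ∈ adjoin F (insert (w / u) S) := by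
    simpa only [div_div_cancel₀ hw₀] using mem_insert (w / u)
  rw [← adjoin_insert_of_mem hu, Set.insert_comm, adjoin_insert_of_mem (mem_insert u)]

theorem mem_adjoin_simple_of_sq_eq_sq {α β : E} (h : β ^ 2 = α ^ 2) : β ∈ F⟮α⟯ := by
  rcases sq_eq_sq_iff_eq_or_eq_neg.mp h with rfl | rfl
  · exact mem_adjoin_simple_self F β
  · exact neg_mem (mem_adjoin_simple_self F α)

theorem exists_eq_add_mul_of_mem_adjoin_simple {α β : E} {a : F} (hα : α ^ 2 = algebraMap F E a)
    (hβ : β ∈ F⟮α⟯) : ∃ u v : F, β = algebraMap F E u + algebraMap F E v * α := by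
  have hint : IsIntegral F α := .of_pow two_pos (hα ▸ isIntegral_algebraMap)
  rw [← mem_toSubalgebra, adjoin_simple_toSubalgebra_of_isAlgebraic hint.isAlgebraic] at hβ
  induction hβ using Algebra.adjoin_induction with
  | mem β h => exact ⟨0, 1, by rw [Set.mem_singleton_iff.mp h, map_zero, map_one]; ring⟩
  | algebraMap r => exact ⟨r, 0, by rw [map_zero, zero_mul, add_zero]⟩
  | add _ _ _ _ hβ hγ =>
    obtain ⟨u, v, rfl⟩ := hβ
    obtain ⟨u', v', rfl⟩ := hγ
    exact ⟨u + u', v + v', by simp only [map_add]; ring⟩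
  | mul _ _ _ _ hβ hγ =>
    obtain ⟨u, v, rfl⟩ := hβ
    obtain ⟨u', v', rfl⟩ := hγ
    exact ⟨u * u' + v * v' * a, u * v' + v * u', by
      simp only [map_add, map_mul]
      linear_combination algebraMap F E v * algebraMap F E v' * hα⟩

theorem isSquare_mul_of_mem_adjoin_simple [NeZero (2 : F)] {α β : E} {a b : F}
    (hα : α ^ 2 = algebraMap F E a) (hβ : β ^ 2 = algebraMap F E b)
    (hβF : β ∉ Set.range (algebraMap F E)) (hmem : β ∈ F⟮α⟯) : IsSquare (a * b) := by
  obtain ⟨u, v, rfl⟩ := exists_eq_add_mul_of_mem_adjoin_simple hα hmem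
  have hcross : algebraMap F E (2 * u * v) * α = algebraMap F E (b - u ^ 2 - v ^ 2 * a) := by
    simp only [map_mul, map_sub, map_pow, map_ofNat]
    linear_combination hβ - algebraMap F E v ^ 2 * hα
  have huv : 2 * u * v = 0 := by
    by_contra huv
    have hα' : α = algebraMap F E ((b - u ^ 2 - v ^ 2 * a) / (2 * u * v)) := by
      rw [map_div₀, ← hcross, mul_div_cancel_left₀ _ ((map_ne_zero _).mpr huv)]
    exact hβF ⟨u + v * ((b - u ^ 2 - v ^ 2 * a) / (2 * u * v)), by
      rw [map_add, map_mul, ← hα']⟩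
  rw [huv, map_zero, zero_mul, eq_comm, map_eq_zero] at hcross
  have hv : v ≠ 0 := fun hv ↦ hβF ⟨u, by rw [hv, map_zero, zero_mul, add_zero]⟩
  have hu : u = 0 := by simpa [hv, two_ne_zero] using huv
  exact ⟨v * a, by rw [hu] at hcross; linear_combination a * hcross⟩

theorem isQuarticGenerator_adjoinPair {d a b k : F} {σ s : E} (hσ : σ ^ 2 = algebraMap F E d)
    (hs : s ^ 2 = algebraMap F E a + algebraMap F E b * σ) (hnorm : a ^ 2 - d * b ^ 2 = d * k ^ 2)
    (hk : k ≠ 0) (hσF : σ ∉ Set.range (algebraMap F E)) :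
    IsQuarticGenerator d a b k (AdjoinPair.gen₁ F σ s) (AdjoinPair.gen₂ F σ s) where
  sq₁ := Subtype.ext hσ
  sq := Subtype.ext hs
  norm_eq := hnorm
  ne_zero := hk
  notMem := fun ⟨r, hr⟩ ↦ hσF ⟨r, congrArg Subtype.val hr⟩
  adjoin_eq_top := by
    rw [← lift_inj, lift_adjoin, lift_top, Set.image_pair]
    rfl

end Adjoin

theorem IsPrimitiveSolution.add_mul_ne_zero {E : Type*} [Field E] [CharZero E] {d₁ d₂ x y z : ℤ}
    (h : IsPrimitiveSolution d₁ d₂ x y z) (hd₁ : ¬ IsSquare d₁) (hd₂ : d₂ ≠ 0) {s₁ : E}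
    (hs₁ : s₁ ^ 2 = d₁) : x + y * s₁ ≠ 0 := fun h₀ ↦ by
  have hnorm : x ^ 2 - d₁ * y ^ 2 = (d₂ * z ^ 2 : E) := by
    exact_mod_cast congrArg (Int.cast (R := E)) (sub_eq_zero.mp h.eq_zero)
  have hdz : (d₂ * z ^ 2 : E) ≠ 0 := by
    exact_mod_cast mul_ne_zero hd₂ (pow_ne_zero 2 (h.ne_zero hd₁))
  exact hdz (by linear_combination (x - y * s₁) * h₀ + y ^ 2 * hs₁ - hnorm)

theorem IsPrimitiveSolution.exists_sq_eq_and_adjoin_eq {F E : Type*} [Field F] [Field E]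
    [CharZero E] [Algebra F E] {d₁ d₂ x y z t e : ℤ} (h : IsPrimitiveSolution d₁ d₂ x y z)
    (hd₁ : ¬ IsSquare d₁) (hd₂ : ¬ IsSquare d₂) (hte : t * e = 2) {s₁ s₂ s : E}
    (hs₁ : s₁ ^ 2 = d₁) (hs₂ : s₂ ^ 2 = d₂) (hs : s ^ 2 = e * x + e * y * s₁) :
    ∃ s' : E, s' ^ 2 = t * x + t * z * s₂ ∧
      IntermediateField.adjoin F {s₂, s₁, s'} = IntermediateField.adjoin F {s₁, s₂, s} := by
  have hα := h.add_mul_ne_zero hd₁ (fun h₀ ↦ hd₂ (h₀ ▸ IsSquare.zero)) hs₁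
  have hβ := h.symm.add_mul_ne_zero hd₂ (fun h₀ ↦ hd₁ (h₀ ▸ IsSquare.zero)) hs₂
  have hnorm : x ^ 2 - d₁ * y ^ 2 - d₂ * z ^ 2 = (0 : E) := by
    exact_mod_cast congrArg (Int.cast (R := E)) h.eq_zero
  have hte' : (t * e : E) = 2 := by exact_mod_cast congrArg (Int.cast (R := E)) hte
  have he : (e : E) ≠ 0 := right_ne_zero_of_mul (hte' ▸ two_ne_zero)
  obtain ⟨w, hw⟩ : ∃ w, w = x + y * s₁ + z * s₂ := ⟨_, rfl⟩
  have hw_sq : w ^ 2 = 2 * (x + y * s₁) * (x + z * s₂) := by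
    rw [hw]
    linear_combination y ^ 2 * hs₁ + z ^ 2 * hs₂ - hnorm
  have hw₀ : w ≠ 0 := (pow_ne_zero_iff two_ne_zero).mp <| by
    rw [hw_sq]
    exact mul_ne_zero (mul_ne_zero two_ne_zero hα) hβ
  have hs_ne : s ^ 2 ≠ 0 := by
    rw [hs, mul_assoc, ← mul_add]
    exact mul_ne_zero he hα
  refine ⟨w / s, ?_, ?_⟩
  · rw [div_pow, div_eq_iff hs_ne, hw_sq, hs, ← hte']
    ring
  · have hmem : w ∈ IntermediateField.adjoin F {s₁, s₂} := by
      rw [hw]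
      exact add_mem (add_mem (intCast_mem _ x)
        (mul_mem (intCast_mem _ y) (IntermediateField.mem_adjoin_pair_left F s₁ s₂)))
        (mul_mem (intCast_mem _ z) (IntermediateField.mem_adjoin_pair_right F s₁ s₂))
    have hrot (u : E) : ({s₁, s₂, u} : Set E) = {u, s₁, s₂} := by
      rw [Set.insert_comm u, Set.pair_comm u]
    rw [Set.insert_comm, hrot, hrot, adjoin_insert_div hmem hw₀]

namespace SatisfiesRedeiConditions

open IntermediateField

variable {E : Type*} [Field E] [CharZero E] {D d₁ d₂ : ℤ} {sD s₁ s₂ : E}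

theorem notMem_adjoin (h : SatisfiesRedeiConditions D d₁ d₂) (hsD : sD ^ 2 = D)
    (hs₁ : s₁ ^ 2 = d₁) : s₁ ∉ ℚ⟮sD⟯ := fun hmem ↦ by
  have hd₁ : s₁ ∉ Set.range (algebraMap ℚ E) := by
    rintro ⟨q, rfl⟩
    refine h.isDiscr₁.not_isSquare (Rat.isSquare_intCast_iff.mp ⟨q, ?_⟩)
    exact (algebraMap ℚ E).injective (by rw [map_intCast, ← hs₁, map_mul, sq])
  obtain ⟨r, hr⟩ := isSquare_mul_of_mem_adjoin_simple (a := (D : ℚ)) (b := d₁)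
    (by rw [hsD, map_intCast]) (by rw [hs₁, map_intCast]) hd₁ hmem
  refine h.isDiscr₂.not_isSquare (Rat.isSquare_intCast_iff.mp ⟨r / d₁, ?_⟩)
  have hd₁' : (d₁ : ℚ) ≠ 0 := by exact_mod_cast h.isDiscr₁.ne_zero
  rw [h.eq_mul, Int.cast_mul] at hr
  field_simp
  linear_combination hr

theorem mul_mem_adjoin (h : SatisfiesRedeiConditions D d₁ d₂) (hsD : sD ^ 2 = D)
    (hs₁ : s₁ ^ 2 = d₁) (hs₂ : s₂ ^ 2 = d₂) : s₁ * s₂ ∈ ℚ⟮sD⟯ :=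
  mem_adjoin_simple_of_sq_eq_sq (by rw [mul_pow, hs₁, hs₂, hsD, h.eq_mul, Int.cast_mul])

theorem adjoin_le_adjoin (h : SatisfiesRedeiConditions D d₁ d₂) (hsD : sD ^ 2 = D)
    (hs₁ : s₁ ^ 2 = d₁) (hs₂ : s₂ ^ 2 = d₂) (s : E) : ℚ⟮sD⟯ ≤ adjoin ℚ {s₁, s₂, s} := by
  have hmem : sD ∈ ℚ⟮s₁ * s₂⟯ :=
    mem_adjoin_simple_of_sq_eq_sq (by rw [mul_pow, hs₁, hs₂, hsD, h.eq_mul, Int.cast_mul])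
  refine (adjoin_simple_le_iff.mpr hmem).trans (adjoin_simple_le_iff.mpr (mul_mem ?_ ?_)) <;>
    exact subset_adjoin ℚ _ (by simp)

theorem adjoin_eq_adjoin_pair (h : SatisfiesRedeiConditions D d₁ d₂) (hsD : sD ^ 2 = D)
    (hs₁ : s₁ ^ 2 = d₁) (hs₂ : s₂ ^ 2 = d₂) (s : E) :
    adjoin ℚ⟮sD⟯ {s₁, s₂, s} = ℚ⟮sD⟯⟮s₁, s⟯ := by
  have hs₁_ne : s₁ ≠ 0 := fun h₀ ↦ h.notMem_adjoin hsD hs₁ (h₀ ▸ zero_mem _)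
  have hs₂_eq : s₂ = algebraMap ℚ⟮sD⟯ E ⟨s₁ * s₂, h.mul_mem_adjoin hsD hs₁ hs₂⟩ / s₁ :=
    (mul_div_cancel_left₀ s₂ hs₁_ne).symm
  rw [Set.insert_comm]
  refine adjoin_insert_of_mem (hs₂_eq ▸ div_mem ?_ (mem_adjoin_pair_left _ s₁ s))
  exact IntermediateField.algebraMap_mem _ _

theorem exists_isQuarticGenerator (h : SatisfiesRedeiConditions D d₁ d₂) {x y z t : ℤ}
    (hxyz : IsPrimitiveSolution d₁ d₂ x y z) (ht : t ≠ 0) (hsD : sD ^ 2 = D) (hs₁ : s₁ ^ 2 = d₁)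
    (hs₂ : s₂ ^ 2 = d₂) {s : E} (hs : s ^ 2 = t * x + t * y * s₁) :
    ∃ k : ℚ⟮sD⟯, IsQuarticGenerator (d₁ : ℚ⟮sD⟯) (t * x) (t * y) k
      (AdjoinPair.gen₁ ℚ⟮sD⟯ s₁ s) (AdjoinPair.gen₂ ℚ⟮sD⟯ s₁ s) := by
  obtain ⟨κ, hκ⟩ : ∃ κ : ℚ⟮sD⟯, (κ : E) = s₁ * s₂ := ⟨⟨_, h.mul_mem_adjoin hsD hs₁ hs₂⟩, rfl⟩
  have hκ_sq : κ ^ 2 = d₁ * d₂ := Subtype.ext (by simp [hκ, mul_pow, hs₁, hs₂])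
  have hd₁ : (d₁ : ℚ⟮sD⟯) ≠ 0 := by exact_mod_cast h.isDiscr₁.ne_zero
  have hκ_ne : κ ≠ 0 := pow_ne_zero_iff two_ne_zero |>.mp
    (hκ_sq ▸ mul_ne_zero hd₁ (by exact_mod_cast h.isDiscr₂.ne_zero))
  have hsol : x ^ 2 - d₁ * y ^ 2 - d₂ * z ^ 2 = (0 : ℚ⟮sD⟯) := by
    exact_mod_cast congrArg (Int.cast (R := ℚ⟮sD⟯)) hxyz.eq_zero
  refine ⟨t * z * κ / d₁, isQuarticGenerator_adjoinPair ?_ ?_ ?_ ?_ ?_⟩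
  · simpa using hs₁
  · simpa using hs
  · field_simp
    linear_combination d₁ * hsol - z ^ 2 * hκ_sq
  · refine div_ne_zero (mul_ne_zero (mul_ne_zero ?_ ?_) hκ_ne) hd₁
    · exact_mod_cast ht
    · exact_mod_cast hxyz.ne_zero h.isDiscr₁.not_isSquare
  · rintro ⟨r, hr⟩
    exact h.notMem_adjoin hsD hs₁ (hr ▸ r.2)

theorem isFinitelyUnramified_and_isCyclicQuartic (h : SatisfiesRedeiConditions D d₁ d₂)
    {x y z t : ℤ} (hxyz : IsPrimitiveSolution d₁ d₂ x y z) (ht : t ∣ 2)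
    (htwist : IsTwoAdicTwist d₁ x y t) (hsD : sD ^ 2 = D) (hs₁ : s₁ ^ 2 = d₁)
    (hs₂ : s₂ ^ 2 = d₂) {s : E} (hs : s ^ 2 = t * x + t * y * s₁) :
    ∃ hle : ℚ⟮sD⟯ ≤ adjoin ℚ {s₁, s₂, s}, IsFinitelyUnramified ℚ⟮sD⟯ (extendScalars hle) ∧
      IsCyclicQuartic ℚ⟮sD⟯ (extendScalars hle) := by
  refine ⟨h.adjoin_le_adjoin hsD hs₁ hs₂ s, ?_⟩
  rw [extendScalars_adjoin, h.adjoin_eq_adjoin_pair hsD hs₁ hs₂]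
  obtain ⟨k, H⟩ := h.exists_isQuarticGenerator hxyz (ne_zero_of_dvd_ne_zero two_ne_zero ht)
    hsD hs₁ hs₂ hs
  obtain ⟨n, hgcd⟩ := h.exists_gcd_eq_two_pow hxyz
  have hint : IsIntegral ℚ sD := .of_pow two_pos
    (hsD ▸ map_intCast (algebraMap ℚ E) D ▸ isIntegral_algebraMap)
  have := adjoin.finiteDimensional hint
  have := H.finiteDimensional
  have : NumberField ℚ⟮sD⟯ := ⟨⟩
  have := NumberField.of_module_finite ℚ⟮sD⟯ ℚ⟮sD⟯⟮s₁, s⟯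
  exact ⟨H.isFinitelyUnramified htwist ht hgcd, H.isCyclicQuartic⟩

end SatisfiesRedeiConditions

theorem mainTheorem7 (D d₁ d₂ : ℤ) (hD : SatisfiesRedeiConditions D d₁ d₂)
    (x y z : ℤ) (hprim : Int.gcd (Int.gcd x y) z = 1)
    (hsol : x ^ 2 - d₁ * y ^ 2 - d₂ * z ^ 2 = 0) :
    ∃ t : ℤ, t ∈ ({1, -1, 2, -2} : Set ℤ) ∧
      ∀ sD s₁ s₂ s : ℂ, sD ^ 2 = (D : ℂ) → s₁ ^ 2 = (d₁ : ℂ) → s₂ ^ 2 = (d₂ : ℂ) →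
        s ^ 2 = (t : ℂ) * x + (t : ℂ) * y * s₁ →
        ∃ h : IntermediateField.adjoin ℚ {sD} ≤ IntermediateField.adjoin ℚ {s₁, s₂, s},
          IsFinitelyUnramified (IntermediateField.adjoin ℚ {sD})
            (IntermediateField.extendScalars h) ∧
          IsCyclicQuartic (IntermediateField.adjoin ℚ {sD})
            (IntermediateField.extendScalars h) := by
  have hxyz : IsPrimitiveSolution d₁ d₂ x y z := ⟨hprim, hsol⟩
  obtain ⟨t, ht, htwist | htwist⟩ := hD.exists_isTwoAdicTwist hxyz
  · refine ⟨t, ht, fun sD s₁ s₂ s hsD hs₁ hs₂ hs ↦ ?_⟩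
    exact hD.isFinitelyUnramified_and_isCyclicQuartic hxyz (dvd_two_of_mem ht) htwist
      hsD hs₁ hs₂ hs
  · obtain ⟨e, he, hte⟩ := exists_mem_mul_eq_two ht
    refine ⟨e, he, fun sD s₁ s₂ s hsD hs₁ hs₂ hs ↦ ?_⟩
    obtain ⟨s', hs', hadjoin⟩ := hxyz.exists_sq_eq_and_adjoin_eq (F := ℚ)
      hD.isDiscr₁.not_isSquare hD.isDiscr₂.not_isSquare hte hs₁ hs₂ hs
    rw [← hadjoin]
    exact hD.symm.isFinitelyUnramified_and_isCyclicQuartic hxyz.symm (dvd_two_of_mem ht) htwist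
      hsD hs₂ hs₁ hs'
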